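/- Let $\Lambda$ be a finite set and let $P$ be a probability on $\{0,1\}^\Lambda$. For $K\subseteq\Lambda$ and $\alpha\in\{0,1\}^K$ write $\alpha\omega$ for the concatenation of $\alpha$ with $\omega\in\{0,1\}^{\Lambda\setminus K}$, let $\overline\omega=1-\omega$ coordinatewise and $|\omega|=\sum_{i}\omega_i$, and let the folding of $P$ along $(K,\alpha)$ be the probability $$P^{K,\alpha}(\omega)=\frac{1}{Z_{K,\alpha}}\,P(\alpha\omega)\,P(\alpha\overline\omega),\qquad \omega\in\{0,1\}^{\Lambda\setminus K},$$ which is defined whenever the right-hand products are not all zero ($Z_{K,\alpha}$ is the normalizing constant). Say that $P$ satisfies the negative FKG condition (is NFKG) if for every $(K,\alpha)$ for which the folding is defined, every $\omega\in\{0,1\}^{\Lambda\setminus K}$ with $\bigl||\omega|-\tfrac{|\Lambda\setminus K|}{2}\bigr|\le\tfrac12$ and every $\omega'\in\{0,1\}^{\Lambda\setminus K}$, $$P^{K,\alpha}(\omega)\ge P^{K,\alpha}(\omega').$$ Say that events $A,B\subseteq\{0,1\}^\Lambda$ have disjoint support if there is a set $N\subseteq\Lambda$ such that for all $\omega\in A\cap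 B$, every configuration that agrees with $\omega$ on $N$ lies in $A$, and every configuration that agrees with $\omega$ on $\Lambda\setminus N$ lies in $B$. **Theorem.** If $P$ is NFKG, then $P$ is negatively associated: $P(A\cap B)\le P(A)\,P(B)$ for all events $A,B\subseteq\{0,1\}^\Lambda$ that are increasing (for the coordinatewise order) and have disjoint support. -/

import Mathlib

open scoped ENNReal

namespace NegAssoc

/-- Configurations in `{0,1}^M`, with `false = 0` and `true = 1`, ordered coordinatewise. -/
abbrev Config (M : Type*) := M → Bool

/-- The number `|ω|` of ones of a configuration. -/
def ones {M : Type*} [Fintype M] (ω : Config M) : ℕ :=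
  (Finset.univ.filter fun i => ω i = true).card

/-- `| |ω| - |M| / 2 | ≤ 1 / 2`: half of the sites are ones, up to rounding. -/
def IsBalanced {M : Type*} [Fintype M] (ω : Config M) : Prop :=
  |(ones ω : ℝ) - (Fintype.card M : ℝ) / 2| ≤ 1 / 2

/-- The reversed configuration, with zeros and ones exchanged at every site. -/
def reverse {M : Type*} (ω : Config M) : Config M := fun i => !(ω i)

/-- Concatenation of a configuration `α` on `K` and a configuration `ω` on the complement of `K`. -/
def concat {Λ : Type*} [DecidableEq Λ] {K : Finset Λ}
    (α : Config {i // i ∈ K}) (ω : Config {i // i ∉ K}) : Config Λ :=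
  fun i => if h : i ∈ K then α ⟨i, h⟩ else ω ⟨i, h⟩

section Folding

variable {Λ : Type*} [DecidableEq Λ]

/-- The unnormalized weight `P(αω) P(α ω̄)` of `ω` in the folding of `P` along `(K, α)`. -/
noncomputable def foldingWeight (P : PMF (Config Λ)) (K : Finset Λ)
    (α : Config {i // i ∈ K}) (ω : Config {i // i ∉ K}) : ℝ≥0∞ :=
  P (concat α ω) * P (concat α (reverse ω))

/-- The folding exists when at least one of the weights is non-zero. -/
def FoldingExists (P : PMF (Config Λ)) (K : Finset Λ) (α : Config {i // i ∈ K}) : Prop :=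
  ∃ ω : Config {i // i ∉ K}, foldingWeight P K α ω ≠ 0

theorem FoldingExists.tsum_ne_zero {P : PMF (Config Λ)} {K : Finset Λ}
    {α : Config {i // i ∈ K}} (h : FoldingExists P K α) :
    (∑' ω, foldingWeight P K α ω) ≠ 0 := by
  obtain ⟨ω, hω⟩ := h
  exact fun h0 => hω (ENNReal.tsum_eq_zero.1 h0 ω)

theorem tsum_foldingWeight_ne_top [Fintype Λ] (P : PMF (Config Λ)) (K : Finset Λ)
    (α : Config {i // i ∈ K}) : (∑' ω, foldingWeight P K α ω) ≠ ∞ := by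
  rw [tsum_fintype]
  exact ENNReal.sum_ne_top.2 fun ω _ =>
    ENNReal.mul_ne_top (P.apply_ne_top _) (P.apply_ne_top _)

/-- The `(K, α)`-folded version `P^{K,α}` of `P`: the probability on the configurations on the
complement of `K` with `P^{K,α}(ω) = P(αω) P(α ω̄) / Z`. -/
noncomputable def folding [Fintype Λ] (P : PMF (Config Λ)) (K : Finset Λ)
    (α : Config {i // i ∈ K}) (h : FoldingExists P K α) : PMF (Config {i // i ∉ K}) :=
  PMF.normalize (foldingWeight P K α) h.tsum_ne_zero (tsum_foldingWeight_ne_top P K α)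

/-- The negative FKG condition: in every folding, each balanced configuration is a maximum. -/
def IsNFKG [Fintype Λ] (P : PMF (Config Λ)) : Prop :=
  ∀ (K : Finset Λ) (α : Config {i // i ∈ K}) (h : FoldingExists P K α)
    (ω : Config {i // i ∉ K}), IsBalanced ω →
      ∀ ω' : Config {i // i ∉ K}, folding P K α h ω' ≤ folding P K α h ω

end Folding

/-- The cylinder `[ω]_N` of configurations that agree with `ω` on `N`. -/
def cylinder {Λ : Type*} (N : Set Λ) (ω : Config Λ) : Set (Config Λ) :=
  {ω' | ∀ i ∈ N, ω' i = ω i}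

/-- Two events have disjoint support if one set `N`, the same for all configurations, is such
that on `A ∩ B` the sites of `N` guarantee `A` and those of the complement guarantee `B`. -/
def DisjointSupport {Λ : Type*} (A B : Set (Config Λ)) : Prop :=
  ∃ N : Set Λ, ∀ ω ∈ A ∩ B, cylinder N ω ⊆ A ∧ cylinder Nᶜ ω ⊆ B

/-- Negative association; `IsUpperSet` says that an event is increasing. -/
def IsNA {Λ : Type*} (P : PMF (Config Λ)) : Prop :=
  ∀ A B : Set (Config Λ), IsUpperSet A → IsUpperSet B → DisjointSupport A B →
    P.toMeasure (A ∩ B) ≤ P.toMeasure A * P.toMeasure B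

end NegAssoc

/-! Duplicate the system. With two independent copies `s`, `t` of `P`, seen as sets of ones, the
covariance of `A` and `B` is half the expectation of `(A s - A t) * (B s - B t)`. It suffices to
show that this sum is non-positive on each fibre where `s ∩ t = a` and `symmDiff s t = d` are fixed.

On such a fibre the weight of `u ⊆ d` is `p (a ∪ u) * p (a ∪ (d \ u))`. It is symmetric under
complement in `d` and inherits the balanced-maximum property (`IsBalancedMax.fold`), which forces it
to be a symmetric unimodal function `c` of `#u` alone (`IsBalancedMax.exists_eq_card`).

If `A` depends on `N` and `B` on its complement, the two differences are odd increasing functions on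
the disjoint sets `d ∩ N` and `d \ N`. Their sums over levels are odd about the middle and
non-positive below it, so unimodality of `c` makes them negatively correlated
(`sum_sum_unimodal_nonpos`).

Disjoint support reduces to this case: pass to the configurations whose cylinder over `N` lies in
`A`, or over `Nᶜ` in `B`. -/

namespace NegAssoc

open Finset

variable {ι : Type*} [DecidableEq ι]

/-- Among the pairs of sets with a given intersection and a given union, those of (almost) equal
sizes maximize the product of the weights. -/
def IsBalancedMax (d : Finset ι) (w : Finset ι → ℝ) : Prop :=
  ∀ s t u v : Finset ι, s ∪ t ⊆ d → s ∩ t = u ∩ v → s ∪ t = u ∪ v → #u ≤ #v + 1 → #v ≤ #u + 1 →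
    w s * w t ≤ w u * w v

/-- Between nested sets there is an almost even redistribution of the difference. -/
theorem exists_balanced_between {s t : Finset ι} (h : s ⊆ t) :
    ∃ u v : Finset ι, s ∩ t = u ∩ v ∧ s ∪ t = u ∪ v ∧ #u = (#s + #t) / 2 ∧
      #u + #v = #s + #t := by
  have hc : #(t \ s) = #t - #s := card_sdiff_of_subset h
  have hst := card_le_card h
  obtain ⟨r, hr, hrc⟩ := exists_subset_card_eq (s := t \ s) (n := (#s + #t) / 2 - #s) (by omega)
  have hsr : Disjoint s r := disjoint_of_subset_right hr disjoint_sdiff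
  have h1 : s ∩ t = (s ∪ r) ∩ (t \ r) := by
    ext i
    have := @hr i
    have := @h i
    have : i ∈ s → i ∉ r := fun a b => disjoint_left.1 hsr a b
    simp only [mem_inter, mem_union, mem_sdiff] at *
    tauto
  have h2 : s ∪ t = (s ∪ r) ∪ (t \ r) := by
    ext i
    have := @hr i
    have := @h i
    simp only [mem_union, mem_sdiff] at *
    tauto
  have h3 : #(s ∪ r) = (#s + #t) / 2 := by
    rw [card_union_of_disjoint hsr, hrc]; omega
  refine ⟨s ∪ r, t \ r, h1, h2, h3, ?_⟩
  rw [← card_union_add_card_inter s t, ← card_union_add_card_inter (s ∪ r) (t \ r), h1, h2]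

/-! ### Symmetric weights with balanced maxima -/

section Unimodal

variable {d : Finset ι} {w : Finset ι → ℝ}

/-- Comparing the complementary pairs of `s` and of `t` gives, by symmetry, an inequality between
squares. -/
theorem IsBalancedMax.le_of_balanced (hw : IsBalancedMax d w) (h0 : ∀ s ⊆ d, 0 ≤ w s)
    (hsymm : ∀ s ⊆ d, w (d \ s) = w s) {s t : Finset ι} (hs : s ⊆ d) (ht : t ⊆ d)
    (h1 : 2 * #t ≤ #d) (h2 : #d ≤ 2 * #t + 1) : w s ≤ w t := by
  have hc : #(d \ t) = #d - #t := card_sdiff_of_subset ht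
  have h := hw s (d \ s) t (d \ t) (by rw [union_sdiff_of_subset hs])
    (by rw [inter_sdiff_self, inter_sdiff_self])
    (by rw [union_sdiff_of_subset hs, union_sdiff_of_subset ht]) (by omega) (by omega)
  rw [hsymm s hs, hsymm t ht] at h
  exact (mul_self_le_mul_self_iff (h0 s hs) (h0 t ht)).2 h

/-- The weight of a set increases with its size, up to half of the sites. -/
theorem IsBalancedMax.le_of_card_le_half (hw : IsBalancedMax d w) (h0 : ∀ s ⊆ d, 0 ≤ w s)
    (hsymm : ∀ s ⊆ d, w (d \ s) = w s) {s t : Finset ι} (hs : s ⊆ d) (ht : t ⊆ d)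
    (hst : #s ≤ #t) (htd : 2 * #t ≤ #d) : w s ≤ w t := by
  obtain ⟨k, hk⟩ : ∃ k, #d / 2 - #s = k := ⟨_, rfl⟩
  induction k using Nat.strong_induction_on generalizing s t with
  | _ k ih =>
  by_cases hbal : #d ≤ 2 * #s + 1
  · exact hw.le_of_balanced h0 hsymm hs ht htd (by omega)
  have ih' : ∀ u v : Finset ι, u ⊆ d → v ⊆ d → #s < #u → #u ≤ #v → 2 * #v ≤ #d → w u ≤ w v :=
    fun u v hu hv h1 h2 h3 => ih (#d / 2 - #u) (by omega) hu hv h2 h3 rfl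
  -- Inner induction on the level of `t`, downwards from the middle; the outer induction covers all
  -- sets larger than `s`.
  have above : ∀ (m : ℕ) (t : Finset ι), t ⊆ d → #s < #t → 2 * #t ≤ #d → #d / 2 - #t = m →
      w s ≤ w t := by
    intro m
    induction m with
    | zero => exact fun t ht h1 h2 h3 => hw.le_of_balanced h0 hsymm hs ht h2 (by omega)
    | succ m ihm =>
      intro t ht h1 h2 h3
      by_contra! hlt
      -- With `#z = #t + 1`, the balanced pair `u`, `v` between `s` and `z` has sizes in `(#s, #t]`,
      -- so `w s * w z ≤ w u * w v ≤ w t * w t`, against `w t < w s ≤ w z`.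
      obtain ⟨z, hsz, hzd, hz⟩ := exists_subsuperset_card_eq hs (n := #t + 1) (by omega) (by omega)
      have hwz : w s ≤ w z := ihm z hzd (by omega) (by omega) (by omega)
      obtain ⟨u, v, e1, e2, c1, c2⟩ := exists_balanced_between hsz
      have hd : u ∪ v ⊆ d := by rw [← e2]; exact union_subset hs hzd
      have hu : u ⊆ d := subset_union_left.trans hd
      have hv : v ⊆ d := subset_union_right.trans hd
      have hF := hw s z u v (e2 ▸ hd) e1 e2 (by omega) (by omega)
      have hut : w u ≤ w t := ih' u t hu ht (by omega) (by omega) h2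
      have hvt : w v ≤ w t := ih' v t hv ht (by omega) (by omega) h2
      have h4 : w u * w v ≤ w t * w t := mul_le_mul hut hvt (h0 v hv) (h0 t ht)
      have h5 : w t * w t < w s * w z :=
        mul_lt_mul'' hlt (hlt.trans_le hwz) (h0 t ht) (h0 t ht)
      linarith
  rcases hst.lt_or_eq with hlt | heq
  · exact above _ t ht hlt htd rfl
  -- For equal sizes, move a common extra site `l` from one set to the other: `insert l s` and
  -- `insert l t` have equal weight by induction, and it cancels if positive.
  obtain ⟨l, hld, hl⟩ : ∃ l ∈ d, l ∉ s ∪ t := by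
    by_contra! hcon
    have h1 := card_le_card (show d ⊆ s ∪ t from hcon)
    have h2 := card_union_le s t
    omega
  rw [mem_union, not_or] at hl
  have hS : insert l s ⊆ d := insert_subset hld hs
  have hT : insert l t ⊆ d := insert_subset hld ht
  have cS : #(insert l s) = #s + 1 := card_insert_of_notMem hl.1
  have cT : #(insert l t) = #t + 1 := card_insert_of_notMem hl.2
  have heqw : w (insert l s) = w (insert l t) :=
    le_antisymm (ih' _ _ hS hT (by omega) (by omega) (by omega))
      (ih' _ _ hT hS (by omega) (by omega) (by omega))
  have hle : w s ≤ w (insert l t) := above _ _ hT (by omega) (by omega) rfl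
  have hF := hw s (insert l t) t (insert l s) (union_subset hs hT)
    (by rw [inter_insert_of_notMem hl.1, inter_insert_of_notMem hl.2, inter_comm])
    (by rw [union_insert, union_insert, union_comm]) (by omega) (by omega)
  rw [heqw] at hF
  rcases (h0 _ hT).eq_or_lt with hz | hpos
  · rw [← hz] at hle
    exact hle.trans (h0 t ht)
  · exact le_of_mul_le_mul_right hF hpos

theorem IsBalancedMax.le_of_card (hw : IsBalancedMax d w) (h0 : ∀ s ⊆ d, 0 ≤ w s)
    (hsymm : ∀ s ⊆ d, w (d \ s) = w s) {s t : Finset ι} (hs : s ⊆ d) (ht : t ⊆ d)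
    (hst : #s ≤ #t) (hd : #s + #t ≤ #d) : w s ≤ w t := by
  by_cases h : 2 * #t ≤ #d
  · exact hw.le_of_card_le_half h0 hsymm hs ht hst h
  · have hc : #(d \ t) = #d - #t := card_sdiff_of_subset ht
    rw [← hsymm t ht]
    exact hw.le_of_card_le_half h0 hsymm hs sdiff_subset (by omega) (by omega)

/-- A symmetric weight with balanced maxima is a symmetric unimodal function of the size. -/
theorem IsBalancedMax.exists_eq_card (hw : IsBalancedMax d w) (h0 : ∀ s ⊆ d, 0 ≤ w s)
    (hsymm : ∀ s ⊆ d, w (d \ s) = w s) :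
    ∃ c : ℕ → ℝ, (∀ s ⊆ d, w s = c #s) ∧ (∀ i ≤ #d, c (#d - i) = c i) ∧
      ∀ i j, i ≤ j → i + j ≤ #d → c i ≤ c j := by
  have hle {s t : Finset ι} (hs : s ⊆ d) (ht : t ⊆ d) (hst : #s = #t) : w s ≤ w t := by
    by_cases h : 2 * #t ≤ #d
    · exact hw.le_of_card h0 hsymm hs ht hst.le (by omega)
    · have hcs : #(d \ s) = #d - #s := card_sdiff_of_subset hs
      have hct : #(d \ t) = #d - #t := card_sdiff_of_subset ht
      rw [← hsymm s hs, ← hsymm t ht]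
      exact hw.le_of_card h0 hsymm sdiff_subset sdiff_subset (by omega) (by omega)
  have hex : ∀ k, ∃ x : ℝ, ∀ s ⊆ d, #s = k → w s = x := by
    intro k
    by_cases h : ∃ s ⊆ d, #s = k
    · obtain ⟨s, hs, rfl⟩ := h
      exact ⟨w s, fun t ht htk => le_antisymm (hle ht hs htk) (hle hs ht htk.symm)⟩
    · push Not at h
      -- No subset of `d` has size `k`, so any value would do.
      exact ⟨0, fun s hs hk => absurd hk (h s hs)⟩
  choose c hc using hex
  refine ⟨c, fun s hs => hc _ s hs rfl, fun i hi => ?_, fun i j hij hd => ?_⟩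
  · obtain ⟨s, hs, rfl⟩ := exists_subset_card_eq hi
    rw [← hc _ s hs rfl, ← hc _ (d \ s) sdiff_subset (card_sdiff_of_subset hs), hsymm s hs]
  · obtain ⟨s, hs, rfl⟩ := exists_subset_card_eq (s := d) (n := i) (by omega)
    obtain ⟨t, ht, rfl⟩ := exists_subset_card_eq (s := d) (n := j) (by omega)
    rw [← hc _ s hs rfl, ← hc _ t ht rfl]
    exact hw.le_of_card h0 hsymm hs ht hij hd

end Unimodal

/-! ### Sums of odd increasing functions over levels -/

section LevelSums

variable {E : Finset ι} {f : Finset ι → ℝ}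

theorem sum_powersetCard_compl (hodd : ∀ x ⊆ E, f (E \ x) = -f x) {i : ℕ} (hi : i ≤ #E) :
    ∑ x ∈ powersetCard (#E - i) E, f x = -∑ x ∈ powersetCard i E, f x := by
  rw [← sum_neg_distrib]
  refine sum_nbij' (E \ ·) (E \ ·) ?_ ?_ ?_ ?_ ?_
  · intro x hx
    rw [mem_powersetCard] at hx ⊢
    exact ⟨sdiff_subset, by rw [card_sdiff_of_subset hx.1]; omega⟩
  · intro x hx
    rw [mem_powersetCard] at hx ⊢
    exact ⟨sdiff_subset, by rw [card_sdiff_of_subset hx.1]; omega⟩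
  · exact fun x hx => Finset.sdiff_sdiff_eq_self (mem_powersetCard.1 hx).1
  · exact fun x hx => Finset.sdiff_sdiff_eq_self (mem_powersetCard.1 hx).1
  · exact fun x hx => by rw [hodd x (mem_powersetCard.1 hx).1, neg_neg]

/-- The sum of an odd increasing function over a level below the middle is non-positive. -/
theorem sum_powersetCard_nonpos (hmono : ∀ x y, x ⊆ y → y ⊆ E → f x ≤ f y)
    (hodd : ∀ x ⊆ E, f (E \ x) = -f x) {i : ℕ} (hi : 2 * i ≤ #E) :
    ∑ x ∈ powersetCard i E, f x ≤ 0 := by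
  -- Double counting of disjoint pairs in the level: disjointness means `x ⊆ E \ z`, whence `f x ≤
  -- -f z`, and every set lies in the same number of such pairs.
  have hfil (x : Finset ι) (hx : x ∈ powersetCard i E) :
      {z ∈ powersetCard i E | Disjoint x z} = powersetCard i (E \ x) := by
    ext z
    simp only [mem_filter, mem_powersetCard, subset_sdiff, disjoint_comm (a := x)]
    tauto
  have hcount (x : Finset ι) (hx : x ∈ powersetCard i E) :
      #{z ∈ powersetCard i E | Disjoint x z} = (#E - i).choose i := by
    rw [hfil x hx, card_powersetCard, card_sdiff_of_subset (mem_powersetCard.1 hx).1,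
      (mem_powersetCard.1 hx).2]
  have e1 : ∑ x ∈ powersetCard i E, ∑ z ∈ powersetCard i E, (if Disjoint x z then f x else 0)
      = (#E - i).choose i * ∑ x ∈ powersetCard i E, f x := by
    rw [mul_sum]
    refine sum_congr rfl fun x hx => ?_
    rw [← sum_filter, sum_const, hcount x hx, nsmul_eq_mul]
  have e2 : ∑ x ∈ powersetCard i E, ∑ z ∈ powersetCard i E, (if Disjoint x z then f z else 0)
      = (#E - i).choose i * ∑ x ∈ powersetCard i E, f x := by
    rw [sum_comm, ← e1]
    simp only [disjoint_comm]
  have hle : ∑ x ∈ powersetCard i E, ∑ z ∈ powersetCard i E,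
      ((if Disjoint x z then f x else 0) + (if Disjoint x z then f z else 0)) ≤ 0 := by
    refine sum_nonpos fun x hx => sum_nonpos fun z hz => ?_
    split_ifs with h
    · rw [mem_powersetCard] at hx hz
      have := hmono x (E \ z) (subset_sdiff.2 ⟨hx.1, h⟩) sdiff_subset
      rw [hodd z hz.1] at this
      linarith
    · simp
  simp only [sum_add_distrib] at hle
  rw [e1, e2] at hle
  have hpos : (0 : ℝ) < (#E - i).choose i := by
    exact_mod_cast Nat.choose_pos (by omega)
  by_contra! hcon
  have := mul_pos hpos hcon
  linarith

theorem sum_powersetCard_nonneg (hmono : ∀ x y, x ⊆ y → y ⊆ E → f x ≤ f y)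
    (hodd : ∀ x ⊆ E, f (E \ x) = -f x) {i : ℕ} (hiE : i ≤ #E) (hi : #E ≤ 2 * i) :
    0 ≤ ∑ x ∈ powersetCard i E, f x := by
  have h := sum_powersetCard_nonpos hmono hodd (i := #E - i) (by omega)
  rw [sum_powersetCard_compl hodd hiE] at h
  linarith

/-- Odd increasing functions of two disjoint sets of sites are negatively correlated under a
symmetric unimodal weight of the total number of ones. -/
theorem sum_sum_unimodal_nonpos {E' : Finset ι} {g : Finset ι → ℝ} {c : ℕ → ℝ}
    (hmono : ∀ x y, x ⊆ y → y ⊆ E → f x ≤ f y) (hodd : ∀ x ⊆ E, f (E \ x) = -f x)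
    (hmono' : ∀ x y, x ⊆ y → y ⊆ E' → g x ≤ g y) (hodd' : ∀ x ⊆ E', g (E' \ x) = -g x)
    (hsymm : ∀ i ≤ #E + #E', c (#E + #E' - i) = c i)
    (huni : ∀ i j, i ≤ j → i + j ≤ #E + #E' → c i ≤ c j) :
    ∑ x ∈ E.powerset, ∑ y ∈ E'.powerset, c (#x + #y) * (f x * g y) ≤ 0 := by
  set F : ℕ → ℝ := fun i => ∑ x ∈ powersetCard i E, f x
  set G : ℕ → ℝ := fun j => ∑ y ∈ powersetCard j E', g y with hG
  have key : ∑ x ∈ E.powerset, ∑ y ∈ E'.powerset, c (#x + #y) * (f x * g y)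
      = ∑ i ∈ range (#E + 1), ∑ j ∈ range (#E' + 1), F i * (G j * c (i + j)) := by
    rw [sum_powerset]
    refine sum_congr rfl fun i _ => ?_
    calc _ = ∑ x ∈ powersetCard i E, ∑ j ∈ range (#E' + 1), f x * (G j * c (i + j)) := by
          refine sum_congr rfl fun x hx => ?_
          rw [sum_powerset]
          refine sum_congr rfl fun j _ => ?_
          rw [hG, sum_mul, mul_sum]
          refine sum_congr rfl fun y hy => ?_
          rw [(mem_powersetCard.1 hx).2, (mem_powersetCard.1 hy).2]
          ring
      _ = _ := by
          rw [sum_comm]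
          exact sum_congr rfl fun j _ => by rw [← sum_mul]
  have flip (i : ℕ) : ∑ j ∈ range (#E' + 1), F i * (G j * c (i + j))
      = -∑ j ∈ range (#E' + 1), F i * (G j * c (i + (#E' - j))) := by
    rw [← sum_flip, ← sum_neg_distrib]
    refine sum_congr rfl fun j hj => ?_
    have : G (#E' - j) = -G j := sum_powersetCard_compl hodd' (by simp at hj; omega)
    rw [this]
    ring
  -- Adding the sum to its flipped form doubles it and leaves a difference of values of `c`, whose
  -- sign is opposite to that of `F i * G j`. For `i` above the middle, `c` is first reflected.
  have hneg : ∑ i ∈ range (#E + 1), ∑ j ∈ range (#E' + 1),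
      F i * G j * (c (i + j) - c (i + (#E' - j))) ≤ 0 := by
    refine sum_nonpos fun i hi => sum_nonpos fun j hj => ?_
    have hi : i ≤ #E := by simp at hi; omega
    have hj : j ≤ #E' := by simp at hj; omega
    have s1 := hsymm (i + j) (by omega)
    have s2 := hsymm (i + (#E' - j)) (by omega)
    rcases le_total (2 * i) #E with h1 | h1 <;> rcases le_total (2 * j) #E' with h2 | h2
    · have a : F i ≤ 0 := sum_powersetCard_nonpos hmono hodd h1
      have b : G j ≤ 0 := sum_powersetCard_nonpos hmono' hodd' h2
      have := huni (i + j) (i + (#E' - j)) (by omega) (by omega)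
      exact mul_nonpos_of_nonneg_of_nonpos (mul_nonneg_of_nonpos_of_nonpos a b) (by linarith)
    · have a : F i ≤ 0 := sum_powersetCard_nonpos hmono hodd h1
      have b : 0 ≤ G j := sum_powersetCard_nonneg hmono' hodd' hj h2
      have := huni (i + (#E' - j)) (i + j) (by omega) (by omega)
      exact mul_nonpos_of_nonpos_of_nonneg (mul_nonpos_of_nonpos_of_nonneg a b) (by linarith)
    · have a : 0 ≤ F i := sum_powersetCard_nonneg hmono hodd hi h1
      have b : G j ≤ 0 := sum_powersetCard_nonpos hmono' hodd' h2
      have := huni (#E + #E' - (i + (#E' - j))) (#E + #E' - (i + j)) (by omega) (by omega)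
      exact mul_nonpos_of_nonpos_of_nonneg (mul_nonpos_of_nonneg_of_nonpos a b) (by linarith)
    · have a : 0 ≤ F i := sum_powersetCard_nonneg hmono hodd hi h1
      have b : 0 ≤ G j := sum_powersetCard_nonneg hmono' hodd' hj h2
      have := huni (#E + #E' - (i + j)) (#E + #E' - (i + (#E' - j))) (by omega) (by omega)
      exact mul_nonpos_of_nonneg_of_nonpos (mul_nonneg a b) (by linarith)
  have hsum : ∑ i ∈ range (#E + 1), ∑ j ∈ range (#E' + 1),
      F i * G j * (c (i + j) - c (i + (#E' - j)))
      = 2 * ∑ i ∈ range (#E + 1), ∑ j ∈ range (#E' + 1), F i * (G j * c (i + j)) := by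
    rw [mul_sum]
    refine sum_congr rfl fun i _ => ?_
    have : ∑ j ∈ range (#E' + 1), F i * G j * (c (i + j) - c (i + (#E' - j)))
        = ∑ j ∈ range (#E' + 1), F i * (G j * c (i + j))
          - ∑ j ∈ range (#E' + 1), F i * (G j * c (i + (#E' - j))) := by
      rw [← sum_sub_distrib]
      exact sum_congr rfl fun j _ => by ring
    rw [this]
    linarith [flip i]
  rw [key]
  linarith

end LevelSums

/-! ### Two independent copies -/

section Pairs

variable {ι : Type*} [DecidableEq ι] {p : Finset ι → ℝ}

/-- Complementing in `d` exchanges unions with intersections and keeps pairs balanced, so the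
hypothesis applies to both factors and the two inequalities multiply. -/
theorem IsBalancedMax.fold {d₀ a d : Finset ι} (hp : IsBalancedMax d₀ p) (h0 : ∀ s, 0 ≤ p s)
    (had : Disjoint a d) (hd : a ∪ d ⊆ d₀) :
    IsBalancedMax d fun u => p (a ∪ u) * p (a ∪ (d \ u)) := by
  intro s t u v hst hi hu h1 h2
  have hs : s ⊆ d := subset_union_left.trans hst
  have ht : t ⊆ d := subset_union_right.trans hst
  have hu' : u ⊆ d := subset_union_left.trans (hu ▸ hst)
  have hv' : v ⊆ d := subset_union_right.trans (hu ▸ hst)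
  have hc (x : Finset ι) (hx : x ⊆ d) : #(a ∪ x) = #a + #x :=
    card_union_of_disjoint (disjoint_of_subset_right hx had)
  have hc' (x : Finset ι) (hx : x ⊆ d) : #(d \ x) = #d - #x := card_sdiff_of_subset hx
  have e1 := hp (a ∪ s) (a ∪ t) (a ∪ u) (a ∪ v)
    ((union_subset (union_subset_union_right hs) (union_subset_union_right ht)).trans hd)
    (by rw [← union_inter_distrib_left, ← union_inter_distrib_left, hi])
    (by rw [← union_union_distrib_left, ← union_union_distrib_left, hu])
    (by rw [hc u hu', hc v hv']; omega) (by rw [hc u hu', hc v hv']; omega)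
  have e2 := hp (a ∪ (d \ s)) (a ∪ (d \ t)) (a ∪ (d \ u)) (a ∪ (d \ v))
    ((union_subset (union_subset_union_right sdiff_subset)
      (union_subset_union_right sdiff_subset)).trans hd)
    (by rw [← union_inter_distrib_left, ← union_inter_distrib_left, ← sdiff_union_distrib,
      ← sdiff_union_distrib, hu])
    (by rw [← union_union_distrib_left, ← union_union_distrib_left, ← sdiff_inter_distrib_right,
      ← sdiff_inter_distrib_right, hi])
    (by rw [hc _ sdiff_subset, hc _ sdiff_subset, hc' u hu', hc' v hv']
        have := card_le_card hu'; have := card_le_card hv'; omega)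
    (by rw [hc _ sdiff_subset, hc _ sdiff_subset, hc' u hu', hc' v hv']
        have := card_le_card hu'; have := card_le_card hv'; omega)
  have h := mul_le_mul e1 e2 (mul_nonneg (h0 _) (h0 _)) (mul_nonneg (h0 _) (h0 _))
  calc _ = p (a ∪ s) * p (a ∪ t) * (p (a ∪ (d \ s)) * p (a ∪ (d \ t))) := by ring
    _ ≤ _ := h
    _ = _ := by ring

variable [Fintype ι] {N : Finset ι} {A B : Finset ι → ℝ}

/-- Negative correlation within the pairs of given intersection and symmetric difference. -/
theorem sum_fiber_nonpos (hp : IsBalancedMax univ p) (h0 : ∀ s, 0 ≤ p s)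
    (hA : Monotone A) (hB : Monotone B) (hAN : ∀ s, A s = A (s ∩ N))
    (hBN : ∀ s, B s = B (s \ N)) (q : Finset ι × Finset ι) :
    ∑ z : Finset ι × Finset ι with (z.1 ∩ z.2, symmDiff z.1 z.2) = q,
      p z.1 * p z.2 * ((A z.1 - A z.2) * (B z.1 - B z.2)) ≤ 0 := by
  obtain ⟨a, d⟩ := q
  by_cases had : Disjoint a d
  swap
  · rw [filter_eq_empty_iff.2, sum_empty]
    rintro ⟨s, t⟩ _ h
    simp only [Prod.mk.injEq] at h
    apply had
    rw [← h.1, ← h.2, disjoint_left]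
    intro i hi hi'
    simp only [mem_inter, mem_symmDiff] at hi hi'
    tauto
  set E := d ∩ N
  set E' := d \ N
  have hEE : #E + #E' = #d := card_inter_add_card_sdiff d N
  obtain ⟨c, hc, hsymm, huni⟩ := (hp.fold h0 had (subset_univ _)).exists_eq_card
    (fun s _ => mul_nonneg (h0 _) (h0 _))
    (fun s hs => by rw [Finset.sdiff_sdiff_eq_self hs, mul_comm])
  rw [← hEE] at hsymm huni
  have hmain := sum_sum_unimodal_nonpos (E := E) (E' := E')
    (f := fun x => A (a ∪ x) - A (a ∪ (E \ x))) (g := fun y => B (a ∪ y) - B (a ∪ (E' \ y)))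
    (fun x y hxy _ => sub_le_sub (hA (union_subset_union_right hxy))
      (hA (union_subset_union_right (sdiff_subset_sdiff subset_rfl hxy))))
    (fun x hx => by rw [Finset.sdiff_sdiff_eq_self hx, neg_sub])
    (fun x y hxy _ => sub_le_sub (hB (union_subset_union_right hxy))
      (hB (union_subset_union_right (sdiff_subset_sdiff subset_rfl hxy))))
    (fun x hx => by rw [Finset.sdiff_sdiff_eq_self hx, neg_sub]) hsymm huni
  refine le_of_eq_of_le ?_ hmain
  rw [← sum_product']
  have hda : ∀ i ∈ a, i ∉ d := fun i hi => disjoint_left.1 had hi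
  -- In the fibre, `s` is `a` together with its traces on `E` and `E'`, and `t` is `a` together with
  -- the rest of `d`.
  refine sum_nbij' (fun z => (z.1 ∩ E, z.1 ∩ E'))
    (fun z => (a ∪ (z.1 ∪ z.2), a ∪ (d \ (z.1 ∪ z.2)))) ?_ ?_ ?_ ?_ ?_
  · exact fun z _ => by simp
  · rintro ⟨x, y⟩ h
    simp only [mem_product, mem_powerset] at h
    have hx := h.1
    have hy := h.2
    simp only [mem_filter, mem_univ, true_and, Prod.mk.injEq]
    constructor <;> ext i <;> have := hda i <;> have := @hx i <;> have := @hy i <;>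
      simp only [E, E', mem_inter, mem_union, mem_sdiff, mem_symmDiff] at * <;> tauto
  · rintro ⟨s, t⟩ h
    simp only [mem_filter, mem_univ, true_and, Prod.mk.injEq] at h
    rw [Prod.mk.injEq, ← h.1]
    constructor <;> ext i <;>
      simp only [E, E', ← h.2, mem_inter, mem_union, mem_sdiff, mem_symmDiff] <;> tauto
  · rintro ⟨x, y⟩ h
    simp only [mem_product, mem_powerset] at h
    have hx := h.1
    have hy := h.2
    rw [Prod.mk.injEq]
    constructor <;> ext i <;> have := hda i <;> have := @hx i <;> have := @hy i <;>
      simp only [E, E', mem_inter, mem_union, mem_sdiff] at * <;> tauto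
  · rintro ⟨s, t⟩ h
    simp only [mem_filter, mem_univ, true_and, Prod.mk.injEq] at h
    obtain ⟨h1, h2⟩ := h
    have hdisj : Disjoint (s ∩ E) (s ∩ E') := by
      rw [disjoint_left]
      intro i hi hi'
      simp only [E, E', mem_inter, mem_sdiff] at hi hi'
      tauto
    have hsub : s ∩ E ∪ s ∩ E' ⊆ d := by
      intro i hi
      simp only [E, E', mem_union, mem_inter, mem_sdiff] at hi
      tauto
    have es : a ∪ (s ∩ E ∪ s ∩ E') = s := by
      ext i
      simp only [E, E', ← h1, ← h2, mem_inter, mem_union, mem_sdiff, mem_symmDiff]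
      tauto
    have et : a ∪ (d \ (s ∩ E ∪ s ∩ E')) = t := by
      ext i
      simp only [E, E', ← h1, ← h2, mem_inter, mem_union, mem_sdiff, mem_symmDiff]
      tauto
    have hw := hc _ hsub
    rw [es, et, card_union_of_disjoint hdisj] at hw
    have a1 : A (a ∪ s ∩ E) = A s := by
      rw [hAN, hAN s]
      congr 1
      ext i
      simp only [E, ← h1, ← h2, mem_inter, mem_union, mem_symmDiff]
      tauto
    have a2 : A (a ∪ (E \ (s ∩ E))) = A t := by
      rw [hAN, hAN t]
      congr 1
      ext i
      simp only [E, ← h1, ← h2, mem_inter, mem_union, mem_sdiff, mem_symmDiff]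
      tauto
    have b1 : B (a ∪ s ∩ E') = B s := by
      rw [hBN, hBN s]
      congr 1
      ext i
      simp only [E', ← h1, ← h2, mem_inter, mem_union, mem_sdiff, mem_symmDiff]
      tauto
    have b2 : B (a ∪ (E' \ (s ∩ E'))) = B t := by
      rw [hBN, hBN t]
      congr 1
      ext i
      simp only [E', ← h1, ← h2, mem_inter, mem_union, mem_sdiff, mem_symmDiff]
      tauto
    simp only
    rw [a1, a2, b1, b2, hw]

/-- Increasing functions of disjoint sets of sites are negatively correlated. -/
theorem IsBalancedMax.sum_mul_le (hp : IsBalancedMax univ p) (h0 : ∀ s, 0 ≤ p s)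
    (hA : Monotone A) (hB : Monotone B) (hAN : ∀ s, A s = A (s ∩ N))
    (hBN : ∀ s, B s = B (s \ N)) :
    (∑ s, p s) * ∑ s, p s * (A s * B s) ≤ (∑ s, p s * A s) * ∑ s, p s * B s := by
  have h : ∑ z : Finset ι × Finset ι,
      p z.1 * p z.2 * ((A z.1 - A z.2) * (B z.1 - B z.2)) ≤ 0 := by
    rw [← sum_fiberwise univ (fun z : Finset ι × Finset ι => (z.1 ∩ z.2, symmDiff z.1 z.2))]
    exact sum_nonpos fun q _ => sum_fiber_nonpos hp h0 hA hB hAN hBN q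
  have e : ∑ z : Finset ι × Finset ι, p z.1 * p z.2 * ((A z.1 - A z.2) * (B z.1 - B z.2))
      = (∑ s, p s * (A s * B s)) * (∑ s, p s) - (∑ s, p s * A s) * (∑ s, p s * B s)
        - (∑ s, p s * B s) * (∑ s, p s * A s) + (∑ s, p s) * ∑ s, p s * (A s * B s) := by
    rw [Fintype.sum_prod_type]
    simp only [sum_mul_sum, ← sum_sub_distrib, ← sum_add_distrib]
    exact sum_congr rfl fun s _ => sum_congr rfl fun t _ => by ring
  linarith

end Pairs

/-! ### From configurations to sets of ones -/

section Transfer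

variable {Λ : Type*} [DecidableEq Λ]

/-- The configuration of a set of ones. -/
def ofFinset (s : Finset Λ) : Config Λ := fun i => decide (i ∈ s)

theorem ofFinset_mono {s t : Finset Λ} (h : s ⊆ t) : ofFinset s ≤ ofFinset t := by
  intro i
  by_cases hi : i ∈ s
  · simp [ofFinset, hi, h hi]
  · simp [ofFinset, hi]

theorem ones_restrict [Fintype Λ] (K u : Finset Λ) :
    ones (fun i : {i // i ∉ K} => ofFinset u i) = #(u \ K) := by
  unfold ones ofFinset
  refine card_nbij (fun i => (i : Λ)) ?_ (fun i _ j _ h => Subtype.ext h) ?_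
  · intro i hi
    simp at hi
    simp [hi, i.2]
  · intro i hi
    simp at hi
    simp [hi]

theorem isBalanced_restrict [Fintype Λ] {K u v : Finset Λ} (hK : ∀ i ∈ K, i ∈ u ↔ i ∈ v)
    (hKc : ∀ i ∉ K, i ∈ v ↔ i ∉ u) (h1 : #u ≤ #v + 1) (h2 : #v ≤ #u + 1) :
    IsBalanced (fun i : {i // i ∉ K} => ofFinset u i) := by
  have hcu : #(u \ K) + #(v \ K) = Fintype.card {i // i ∉ K} := by
    rw [← card_union_of_disjoint, Fintype.card_subtype]
    · congr 1
      ext i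
      have := hKc i
      simp only [mem_union, mem_sdiff, mem_filter, mem_univ, true_and]
      tauto
    · rw [disjoint_left]
      intro i
      have := hKc i
      simp only [mem_sdiff]
      tauto
  have hKuv : u ∩ K = v ∩ K := by
    ext i
    have := hK i
    simp only [mem_inter]
    tauto
  have cu := card_inter_add_card_sdiff u K
  have cv := card_inter_add_card_sdiff v K
  rw [hKuv] at cu
  have l1 : #(u \ K) ≤ #(v \ K) + 1 := by omega
  have l2 : #(v \ K) ≤ #(u \ K) + 1 := by omega
  rw [IsBalanced, ones_restrict, ← hcu, abs_le]
  push_cast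
  have l1' : (#(u \ K) : ℝ) ≤ #(v \ K) + 1 := by exact_mod_cast l1
  have l2' : (#(v \ K) : ℝ) ≤ #(u \ K) + 1 := by exact_mod_cast l2
  constructor <;> linarith

theorem concat_restrict {K : Finset Λ} {ω η : Config Λ} (h : ∀ i ∈ K, ω i = η i) :
    concat (fun i : {i // i ∈ K} => η i) (fun i : {i // i ∉ K} => ω i) = ω := by
  funext i
  by_cases hi : i ∈ K
  · simp [concat, hi, h i hi]
  · simp [concat, hi]

variable [Fintype Λ] {P : PMF (Config Λ)}

theorem IsNFKG.foldingWeight_le (hP : IsNFKG P) (K : Finset Λ) (α : Config {i // i ∈ K})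
    {ω : Config {i // i ∉ K}} (hω : IsBalanced ω) (ω' : Config {i // i ∉ K}) :
    foldingWeight P K α ω' ≤ foldingWeight P K α ω := by
  by_cases h : FoldingExists P K α
  · have h1 := hP K α h ω hω ω'
    rw [folding, PMF.normalize_apply, PMF.normalize_apply] at h1
    exact (ENNReal.mul_le_mul_iff_left (ENNReal.inv_ne_zero.2 (tsum_foldingWeight_ne_top P K α))
      (ENNReal.inv_ne_top.2 h.tsum_ne_zero)).1 h1
  · simp only [FoldingExists, not_exists, not_not] at h
    rw [h ω']
    exact zero_le

/-- Fold along the set `K` of sites where `s` and `t` agree. Off `K` the pairs `s`, `t` and `u`, `v`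
are mutual reverses, so the folding weights are the two products. -/
theorem IsNFKG.isBalancedMax (hP : IsNFKG P) :
    IsBalancedMax univ fun s => (P (ofFinset s)).toReal := by
  intro s t u v _ hi hu h1 h2
  have hi' (i : Λ) : i ∈ s ∧ i ∈ t ↔ i ∈ u ∧ i ∈ v := by
    simpa only [mem_inter] using Finset.ext_iff.1 hi i
  have hu' (i : Λ) : i ∈ s ∨ i ∈ t ↔ i ∈ u ∨ i ∈ v := by
    simpa only [mem_union] using Finset.ext_iff.1 hu i
  set K : Finset Λ := (symmDiff s t)ᶜ
  have memK (i : Λ) : i ∈ K ↔ (i ∈ s ↔ i ∈ t) := by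
    simp only [K, mem_compl, mem_symmDiff]; tauto
  set α : Config {i // i ∈ K} := fun i => ofFinset s i
  have agree (x : Finset Λ) (hx : ∀ i ∈ K, i ∈ x ↔ i ∈ s) :
      concat α (fun i : {i // i ∉ K} => ofFinset x i) = ofFinset x :=
    concat_restrict fun i hi => by simp only [ofFinset, hx i hi]
  have rev (x y : Finset Λ) (h : ∀ i ∉ K, i ∈ y ↔ i ∉ x) :
      reverse (fun i : {i // i ∉ K} => ofFinset x i) = fun i : {i // i ∉ K} => ofFinset y i := by
    funext i
    simp [reverse, ofFinset, h i i.2]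
  have weight (x y : Finset Λ) (hx : ∀ i ∈ K, i ∈ x ↔ i ∈ s) (hy : ∀ i ∈ K, i ∈ y ↔ i ∈ s)
      (h : ∀ i ∉ K, i ∈ y ↔ i ∉ x) :
      foldingWeight P K α (fun i => ofFinset x i) = P (ofFinset x) * P (ofFinset y) := by
    rw [foldingWeight, rev x y h, agree x hx, agree y hy]
  have hbal : IsBalanced (fun i : {i // i ∉ K} => ofFinset u i) :=
    isBalanced_restrict (v := v) (fun i hi => by
        have := hi' i
        have := hu' i
        rw [memK] at hi
        tauto)
      (fun i hi => by
        have := hi' i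
        have := hu' i
        rw [memK] at hi
        tauto) h1 h2
  have h := hP.foldingWeight_le K α hbal (fun i => ofFinset s i)
  rw [weight s t (fun i _ => Iff.rfl) (fun i h => ((memK i).1 h).symm)
      (fun i h => by rw [memK] at h; tauto),
    weight u v (fun i h => by have := hi' i; have := hu' i; rw [memK] at h; tauto)
      (fun i h => by have := hi' i; have := hu' i; rw [memK] at h; tauto)
      (fun i h => by have := hi' i; have := hu' i; rw [memK] at h; tauto)] at h
  simp only [← ENNReal.toReal_mul]
  exact ENNReal.toReal_mono (ENNReal.mul_ne_top (P.apply_ne_top _) (P.apply_ne_top _)) h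

/-- Configurations correspond to their sets of ones. -/
def ofFinsetEquiv : Finset Λ ≃ Config Λ where
  toFun := ofFinset
  invFun ω := {i | ω i = true}
  left_inv s := by ext i; simp [ofFinset]
  right_inv ω := by funext i; simp [ofFinset]

open Classical in
theorem toReal_toMeasure_eq_sum (P : PMF (Config Λ)) (S : Set (Config Λ)) :
    (P.toMeasure S).toReal
      = ∑ s : Finset Λ, (P (ofFinset s)).toReal * (if ofFinset s ∈ S then 1 else 0) := by
  rw [PMF.toMeasure_apply_fintype, ENNReal.toReal_sum]
  · refine (Fintype.sum_equiv ofFinsetEquiv _ _ fun s => ?_).symm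
    change _ = (S.indicator P (ofFinset s)).toReal
    by_cases h : ofFinset s ∈ S <;> simp [h]
  · intro ω _
    by_cases h : ω ∈ S <;> simp [h, P.apply_ne_top]

/-- Negative correlation of increasing events that are determined by disjoint sets of sites. -/
theorem IsNFKG.toMeasure_inter_le (hP : IsNFKG P) {A B : Set (Config Λ)} (hA : IsUpperSet A)
    (hB : IsUpperSet B) (N : Set Λ) (hAN : ∀ ω η, (∀ i ∈ N, ω i = η i) → (ω ∈ A ↔ η ∈ A))
    (hBN : ∀ ω η, (∀ i ∉ N, ω i = η i) → (ω ∈ B ↔ η ∈ B)) :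
    P.toMeasure (A ∩ B) ≤ P.toMeasure A * P.toMeasure B := by
  classical
  have hmono (S : Set (Config Λ)) (hS : IsUpperSet S) :
      Monotone fun s : Finset Λ => if ofFinset s ∈ S then (1 : ℝ) else 0 := by
    intro s t hst
    by_cases h : ofFinset s ∈ S
    · simp [h, hS (ofFinset_mono hst) h]
    · simp only [h, if_false]
      split_ifs <;> norm_num
  have h := hP.isBalancedMax.sum_mul_le (N := N.toFinset) (fun s => ENNReal.toReal_nonneg)
    (hmono A hA) (hmono B hB)
    (fun s => by
      simp only [hAN (ofFinset s) (ofFinset (s ∩ N.toFinset))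
        fun i hi => by simp [ofFinset, hi]])
    (fun s => by
      simp only [hBN (ofFinset s) (ofFinset (s \ N.toFinset))
        fun i hi => by simp [ofFinset, hi]])
  have hone : ∑ s : Finset Λ, (P (ofFinset s)).toReal = 1 := by
    have := toReal_toMeasure_eq_sum P Set.univ
    simpa using this.symm
  have hinter : ∑ s : Finset Λ, (P (ofFinset s)).toReal *
      ((if ofFinset s ∈ A then (1 : ℝ) else 0) * (if ofFinset s ∈ B then 1 else 0))
      = (P.toMeasure (A ∩ B)).toReal := by
    rw [toReal_toMeasure_eq_sum]
    refine sum_congr rfl fun s _ => ?_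
    by_cases h1 : ofFinset s ∈ A <;> by_cases h2 : ofFinset s ∈ B <;> simp [h1, h2]
  rw [hone, one_mul, hinter, ← toReal_toMeasure_eq_sum, ← toReal_toMeasure_eq_sum,
    ← ENNReal.toReal_mul] at h
  have hfin (S : Set (Config Λ)) : P.toMeasure S ≠ ∞ := MeasureTheory.measure_ne_top _ _
  exact (ENNReal.toReal_le_toReal (hfin _) (ENNReal.mul_ne_top (hfin _) (hfin _))).1 h

end Transfer

/-! ### Reduction of disjoint support to disjoint sets of sites -/

theorem IsUpperSet.setOf_cylinder_subset {Λ : Type*} {A : Set (Config Λ)} (hA : IsUpperSet A)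
    (N : Set Λ) : IsUpperSet {ω | cylinder N ω ⊆ A} := by
  classical
  intro ω η hωη hω ξ hξ
  -- Lowering `ξ` to `ω` on `N` lands in the cylinder of `ω`, hence in `A`.
  refine hA (a := fun i => if i ∈ N then ω i else ξ i) (fun i => ?_) (hω fun i hi => by simp [hi])
  by_cases hi : i ∈ N
  · simpa [hi, hξ i hi] using hωη i
  · simp [hi]

theorem cylinder_congr {Λ : Type*} {N : Set Λ} {ω η : Config Λ} (h : ∀ i ∈ N, ω i = η i) :
    cylinder N ω = cylinder N η := by
  ext ξ
  exact forall₂_congr fun i hi => by rw [h i hi]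

theorem IsNFKG.isNA {Λ : Type*} [Fintype Λ] [DecidableEq Λ] {P : PMF (Config Λ)}
    (hP : IsNFKG P) : IsNA P := by
  rintro A B hA hB ⟨N, hN⟩
  have hsub (M : Set Λ) (S : Set (Config Λ)) : {ω | cylinder M ω ⊆ S} ⊆ S :=
    fun ω hω => hω fun _ _ => rfl
  calc P.toMeasure (A ∩ B)
      ≤ P.toMeasure ({ω | cylinder N ω ⊆ A} ∩ {ω | cylinder Nᶜ ω ⊆ B}) :=
        MeasureTheory.measure_mono hN
    _ ≤ P.toMeasure {ω | cylinder N ω ⊆ A} * P.toMeasure {ω | cylinder Nᶜ ω ⊆ B} :=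
        hP.toMeasure_inter_le (IsUpperSet.setOf_cylinder_subset hA N)
          (IsUpperSet.setOf_cylinder_subset hB Nᶜ) N
          (fun ω η h => by rw [Set.mem_ofPred_eq, Set.mem_ofPred_eq, cylinder_congr h])
          (fun ω η h => by
            rw [Set.mem_ofPred_eq, Set.mem_ofPred_eq, cylinder_congr (N := Nᶜ) h])
    _ ≤ _ := mul_le_mul' (MeasureTheory.measure_mono (hsub N A))
        (MeasureTheory.measure_mono (hsub Nᶜ B))

end NegAssoc

theorem mainTheorem5 {Λ : Type*} [Fintype Λ] [DecidableEq Λ]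
    (P : PMF (NegAssoc.Config Λ)) (hP : NegAssoc.IsNFKG P) : NegAssoc.IsNA P :=
  hP.isNA
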